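/- Let $p\ge 1$ be an integer. Let $G$ be the Vilenkin group of all sequences $x=(x_j)_{j\in\mathbb Z}$ with $x_j\in\{0,1,\dots,p-1\}$ and $x_j=0$ for all $j<k(x)$, with coordinatewise addition $\oplus$ modulo $p$ and the topology in which the sets $x\oplus U_l$, $l\in\mathbb Z$, are a neighbourhood base at $x$, where $U_l=\{x\in G: x_j=0 \text{ for } j\le l\}$. Put $U=U_0$ and let $\mu$ be the Haar measure on the Borel sets of $G$ with $\mu(U)=1$. The dual group $G^*$ consists of the same kind of sequences $\omega=(\omega_j)$, with operation, topology, subgroup $U^*$ and Haar measure $\mu^*$ defined in the same way; it is paired with $G$ by $$\chi(x,\omega)=\exp\Big(\frac{2\pi i}{p}\sum_{j\in\mathbb Z}x_j\,\omega_{1-j}\Big).$$ Let $H=\{x\in G: x_j=0\text{ for }j>0\}$, with annihilator $H^\perp=\{\omega\in G^*:\chi(h,\omega)=1\ \text{for all } h\in H\}$. For $h \in H$ and $\phi\in L^2(G)$ put $(T_h\phi)(x)=\phi(x\ominus h)$. Let $f\mapsto\hat f$, $L^2(G)\to L^2(G^*)$, be the Fourier transform, i.e. the continuous linear extension of $\hat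 f(\omega)=\int_G f(x)\overline{\chi(x,\omega)}\,d\mu(x)$ from $L^1(G)\cap L^2(G)$. For $f,g\in L^2(G^*)$ let $$[f,g](\omega)=\sum_{h\in H^\perp}f(\omega\oplus h)\,\overline{g(\omega\oplus h)} .$$ A family $(f_h)_{h\in H}$ in a complex Hilbert space is called a frame sequence with frame bounds $C$ and $D$, where $0<C\le D<\infty$, if the synthesis operator $Tc=\sum_{h\in H}c_hf_h$ is well defined (the series converges) for every $c\in\ell^2(H)$, and $$C\|c\|^2\le\|Tc\|^2\le D\|c\|^2\qquad\text{for all } c\in(\operatorname{Ker}T)^\perp .$$ **Theorem.** Let $\phi\in L^2(G)$ and $0<C\le D<\infty$. Then $\{T_h\phi:h\in H\}$ is a frame sequence in $L^2(G)$ with frame bounds $C$ and $D$ if and only if $$C\le[\hat\phi,\hat\phi](\omega)\le D\qquad\text{for a.e. }\omega\in U^*\setminus\mathcal N_\phi,$$ where $\mathcal N_\phi=\{\omega\in U^*:[\hat\phi,\hat\phi](\omega)=0\}$. -/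

import Mathlib

open MeasureTheory Filter Topology
open scoped ComplexConjugate ENNReal

/-! ### Frame sequences in a Hilbert space -/

section FrameSequence

variable {ι E : Type*} [NormedAddCommGroup E] [InnerProductSpace ℂ E]

/-- The synthesis operator `c ↦ ∑ c_j f_j` is well defined on `ℓ²(ι)`: the series converges for
every square summable `c`. -/
def SynthesisWellDefined (f : ι → E) : Prop :=
  ∀ c : lp (fun _ : ι => ℂ) 2, Summable fun j => c j • f j

/-- The synthesis operator `c ↦ ∑ c_j f_j` on `ℓ²(ι)`. -/
noncomputable def synthesis (f : ι → E) (hf : SynthesisWellDefined f) :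
    lp (fun _ : ι => ℂ) 2 →ₗ[ℂ] E where
  toFun c := ∑' j, c j • f j
  map_add' c d := by
    rw [← (hf c).tsum_add (hf d)]
    simp [add_smul]
  map_smul' a c := by
    rw [RingHom.id_apply, ← (hf c).tsum_const_smul a]
    simp [smul_smul]

/-- `f` is a frame sequence with frame bounds `C` and `D`: `0 < C ≤ D < ∞`, the synthesis operator
`T` is well defined on `ℓ²`, and `C ‖c‖² ≤ ‖T c‖² ≤ D ‖c‖²` for every `c ∈ (Ker T)ᗮ`. -/
def IsFrameSequence (f : ι → E) (C D : ℝ) : Prop :=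
  0 < C ∧ C ≤ D ∧ ∃ hf : SynthesisWellDefined f,
    ∀ c ∈ (LinearMap.ker (synthesis f hf))ᗮ,
      C * ‖c‖ ^ 2 ≤ ‖synthesis f hf c‖ ^ 2 ∧ ‖synthesis f hf c‖ ^ 2 ≤ D * ‖c‖ ^ 2

end FrameSequence

/-! ### The Vilenkin group -/

/-- The sequences `(x_j)`, `j ∈ ℤ`, of residues mod `p` with `x_j = 0` for all `j < k(x)`. -/
def eventuallyZero (p : ℕ) : AddSubgroup (ℤ → ZMod p) where
  carrier := {x | ∃ k : ℤ, ∀ j < k, x j = 0}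
  zero_mem' := ⟨0, fun _ _ => rfl⟩
  add_mem' := by
    rintro x y ⟨k, hk⟩ ⟨l, hl⟩
    refine ⟨min k l, fun j hj => ?_⟩
    simp [hk j (lt_of_lt_of_le hj (min_le_left _ _)), hl j (lt_of_lt_of_le hj (min_le_right _ _))]
  neg_mem' := by
    rintro x ⟨k, hk⟩
    exact ⟨k, fun j hj => by simp [hk j hj]⟩

/-- The Vilenkin group `G`, with coordinatewise addition mod `p`. A separate type, so that it does
not carry the topology of pointwise convergence. Its dual group `G*` consists of the same sequences
with the same operation, topology and Haar measure, paired with `G` by `Vilenkin.chi`. -/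
def VilenkinGroup (p : ℕ) : Type := eventuallyZero p

namespace Vilenkin

variable (p : ℕ)

instance : AddCommGroup (VilenkinGroup p) := inferInstanceAs (AddCommGroup (eventuallyZero p))

instance : CoeFun (VilenkinGroup p) (fun _ => ℤ → ZMod p) := ⟨fun x => Subtype.val x⟩

variable {p}

theorem ext {x y : VilenkinGroup p} (h : ∀ j, x j = y j) : x = y := Subtype.ext (funext h)

theorem exists_zero (x : VilenkinGroup p) : ∃ k : ℤ, ∀ j < k, x j = 0 := Subtype.property x

@[simp] theorem zero_apply (j : ℤ) : (0 : VilenkinGroup p) j = 0 := rfl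

@[simp] theorem add_apply (x y : VilenkinGroup p) (j : ℤ) : (x + y) j = x j + y j := rfl

@[simp] theorem neg_apply (x : VilenkinGroup p) (j : ℤ) : (-x) j = -x j := rfl

@[simp] theorem sub_apply (x y : VilenkinGroup p) (j : ℤ) : (x - y) j = x j - y j := by
  rw [sub_eq_add_neg, add_apply, neg_apply, sub_eq_add_neg]

variable (p)

/-- `U_l = {x ∈ G : x_j = 0 for j ≤ l}`. -/
def U (l : ℤ) : AddSubgroup (VilenkinGroup p) where
  carrier := {x | ∀ j ≤ l, x j = 0}
  zero_mem' := fun _ _ => rfl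
  add_mem' := fun hx hy j hj => by simp [hx j hj, hy j hj]
  neg_mem' := fun hx j hj => by simp [hx j hj]

/-- The topology in which the sets `x + U_l`, `l ∈ ℤ`, form a base of neighbourhoods of `x`. -/
instance : TopologicalSpace (VilenkinGroup p) where
  IsOpen s := ∀ x ∈ s, ∃ l : ℤ, ∀ u ∈ U p l, x + u ∈ s
  isOpen_univ := fun _ _ => ⟨0, fun _ _ => trivial⟩
  isOpen_inter := by
    rintro s t hs ht x ⟨hxs, hxt⟩
    obtain ⟨k, hk⟩ := hs x hxs
    obtain ⟨l, hl⟩ := ht x hxt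
    exact ⟨max k l, fun u hu =>
      ⟨hk u fun j hj => hu j (hj.trans (le_max_left _ _)),
        hl u fun j hj => hu j (hj.trans (le_max_right _ _))⟩⟩
  isOpen_sUnion := by
    rintro S hS x ⟨s, hs, hx⟩
    obtain ⟨l, hl⟩ := hS s hs x hx
    exact ⟨l, fun u hu => ⟨s, hs, hl u hu⟩⟩

variable {p}

theorem isOpen_iff {s : Set (VilenkinGroup p)} :
    IsOpen s ↔ ∀ x ∈ s, ∃ l : ℤ, ∀ u ∈ U p l, x + u ∈ s := Iff.rfl

theorem isOpen_coset (x : VilenkinGroup p) (l : ℤ) : IsOpen {y | y - x ∈ U p l} := by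
  refine isOpen_iff.2 fun y hy => ⟨l, fun u hu => ?_⟩
  have : y + u - x = (y - x) + u := by abel
  simpa [this] using (U p l).add_mem hy hu

theorem hasBasis_nhds (x : VilenkinGroup p) :
    (𝓝 x).HasBasis (fun _ : ℤ => True) (fun l => {y | y - x ∈ U p l}) := by
  refine ⟨fun s => ?_⟩
  rw [mem_nhds_iff]
  constructor
  · rintro ⟨t, hts, ht, hx⟩
    obtain ⟨l, hl⟩ := isOpen_iff.1 ht x hx
    exact ⟨l, trivial, fun y hy => hts (by simpa using hl _ hy)⟩
  · rintro ⟨l, -, hl⟩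
    exact ⟨_, hl, isOpen_coset x l, by simp [(U p l).zero_mem]⟩

instance : IsTopologicalAddGroup (VilenkinGroup p) where
  continuous_add := by
    refine continuous_iff_continuousAt.2 fun ⟨a, b⟩ => ?_
    refine (((hasBasis_nhds a).prod_nhds (hasBasis_nhds b)).tendsto_iff (hasBasis_nhds (a + b))).2
      fun l _ => ⟨(l, l), ⟨trivial, trivial⟩, fun ⟨c, d⟩ ⟨hc, hd⟩ => ?_⟩
    have : c + d - (a + b) = (c - a) + (d - b) := by abel
    simpa [this] using (U p l).add_mem hc hd
  continuous_neg := by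
    refine continuous_iff_continuousAt.2 fun a => ?_
    refine ((hasBasis_nhds a).tendsto_iff (hasBasis_nhds (-a))).2
      fun l _ => ⟨l, trivial, fun c hc => ?_⟩
    have : -c - -a = -(c - a) := by abel
    show -c - -a ∈ U p l
    rw [this]
    exact (U p l).neg_mem hc

theorem isOpen_U (l : ℤ) : IsOpen (U p l : Set (VilenkinGroup p)) := by
  simpa using isOpen_coset (0 : VilenkinGroup p) l

variable (p)

/-- Keep the coordinates with `j > l`, and replace the others by `0`. -/
def cut (l : ℤ) (x : ℤ → ZMod p) : VilenkinGroup p :=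
  ⟨fun j => if l < j then x j else 0, l, fun _ hj => if_neg (not_lt.2 hj.le)⟩

variable {p} in
theorem cut_apply (l : ℤ) (x : ℤ → ZMod p) (j : ℤ) :
    cut p l x j = if l < j then x j else 0 := rfl

theorem isCompact_U [NeZero p] (l : ℤ) : IsCompact (U p l : Set (VilenkinGroup p)) := by
  let _ : TopologicalSpace (ZMod p) := ⊥
  have _ : DiscreteTopology (ZMod p) := ⟨rfl⟩
  have hc : Continuous (cut p l) := by
    refine continuous_iff_continuousAt.2 fun x => ?_
    refine (hasBasis_nhds _).tendsto_right_iff.2 fun m _ => ?_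
    have hfin : (Set.Ioc l m).Finite := Set.finite_Ioc l m
    have h : ∀ᶠ y in 𝓝 x, ∀ j ∈ Set.Ioc l m, y j = x j := by
      refine (eventually_all_finite hfin).2 fun j _ => ?_
      exact (continuous_apply j).continuousAt.eventually
        (mem_nhds_discrete.2 (Set.mem_singleton (x j)))
    filter_upwards [h] with y hy j hj
    rw [sub_apply, cut_apply, cut_apply]
    split_ifs with hlj
    · rw [hy j ⟨hlj, hj⟩, sub_self]
    · exact sub_self 0
  have hr : (U p l : Set (VilenkinGroup p)) = Set.range (cut p l) := by
    ext x
    constructor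
    · intro hx
      refine ⟨x, ext fun j => ?_⟩
      rw [cut_apply]
      split_ifs with h
      · rfl
      · exact (hx j (not_lt.1 h)).symm
    · rintro ⟨y, rfl⟩ j hj
      rw [cut_apply, if_neg (not_lt.2 hj)]
  rw [hr]
  exact isCompact_range hc

instance : MeasurableSpace (VilenkinGroup p) := borel _

instance : BorelSpace (VilenkinGroup p) := ⟨rfl⟩

/-- The Haar measure on the Borel sets of `G` with `μ(U_0) = 1`. -/
noncomputable def haar [NeZero p] : Measure (VilenkinGroup p) :=
  Measure.addHaarMeasure
    ⟨⟨(U p 0 : Set (VilenkinGroup p)), isCompact_U p 0⟩,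
      ⟨0, by rw [(isOpen_U 0).interior_eq]; exact (U p 0).zero_mem⟩⟩

instance [NeZero p] : (haar p).IsAddHaarMeasure := by
  unfold haar
  infer_instance

theorem haar_U [NeZero p] : haar p (U p 0) = 1 := Measure.addHaarMeasure_self

/-- The Hilbert space `L²(G)`. -/
abbrev L2 [NeZero p] : Type := Lp (α := VilenkinGroup p) ℂ 2 (haar p)

/-! ### Characters, the subgroup `H` and its annihilator -/

variable {p}

/-- `χ(x, ω) = exp((2πi/p) ∑_{j ∈ ℤ} x_j ω_{1-j})`; the sum has finitely many nonzero terms, and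
`ZMod.stdAddChar` is the map `a ↦ exp(2πi a/p)` on residues mod `p`. -/
noncomputable def chi [NeZero p] (x ω : VilenkinGroup p) : ℂ :=
  ZMod.stdAddChar (∑ᶠ j : ℤ, x j * ω (1 - j))

theorem finite_support (x ω : VilenkinGroup p) : {j : ℤ | x j ≠ 0 ∧ ω (1 - j) ≠ 0}.Finite := by
  obtain ⟨k, hk⟩ := exists_zero x
  obtain ⟨l, hl⟩ := exists_zero ω
  refine (Set.finite_Icc k (1 - l)).subset fun j hj => ⟨?_, ?_⟩
  · exact not_lt.1 fun h => hj.1 (hk j h)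
  · by_contra h
    exact hj.2 (hl (1 - j) (by omega))

/-- The formula for `χ` with representatives `0 ≤ x_j, ω_j < p`. -/
theorem chi_eq_exp [NeZero p] (x ω : VilenkinGroup p) :
    chi x ω = Complex.exp (2 * Real.pi * Complex.I / p *
      ∑ᶠ j : ℤ, ((x j).val : ℂ) * ((ω (1 - j)).val : ℂ)) := by
  have hs := finite_support x ω
  have h1 : ∑ᶠ j : ℤ, x j * ω (1 - j) =
      ((∑ j ∈ hs.toFinset, ((x j).val : ℤ) * ((ω (1 - j)).val : ℤ) : ℤ) : ZMod p) := by
    rw [finsum_eq_sum_of_support_subset (s := hs.toFinset)]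
    · simp
    · intro j hj
      have hj' : x j * ω (1 - j) ≠ 0 := hj
      rw [hs.coe_toFinset]
      exact ⟨left_ne_zero_of_mul hj', right_ne_zero_of_mul hj'⟩
  have h2 : ∑ᶠ j : ℤ, ((x j).val : ℂ) * ((ω (1 - j)).val : ℂ) =
      ∑ j ∈ hs.toFinset, ((x j).val : ℂ) * ((ω (1 - j)).val : ℂ) := by
    refine finsum_eq_sum_of_support_subset _ fun j hj => ?_
    have hj' : ((x j).val : ℂ) * ((ω (1 - j)).val : ℂ) ≠ 0 := hj
    rw [hs.coe_toFinset]
    exact ⟨fun h => hj' (by simp [h]), fun h => hj' (by simp [h])⟩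
  rw [chi, h1, ZMod.stdAddChar_coe, h2]
  congr 1
  push_cast
  ring

variable (p)

/-- `H = {x ∈ G : x_j = 0 for j > 0}`. -/
def H : AddSubgroup (VilenkinGroup p) where
  carrier := {x | ∀ j > 0, x j = 0}
  zero_mem' := fun _ _ => rfl
  add_mem' := fun hx hy j hj => by simp [hx j hj, hy j hj]
  neg_mem' := fun hx j hj => by simp [hx j hj]

/-- The annihilator `H^⊥ = {ω ∈ G* : χ(h, ω) = 1 for all h ∈ H}`. -/
def Hperp [NeZero p] : Set (VilenkinGroup p) := {ω | ∀ h ∈ H p, chi h ω = 1}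

variable {p} in
/-- `H^⊥` consists of the `ω ∈ G*` with `ω_j = 0` for `j > 0`. -/
theorem mem_Hperp_iff [NeZero p] {ω : VilenkinGroup p} : ω ∈ Hperp p ↔ ∀ j > 0, ω j = 0 := by
  constructor
  · intro hω j hj
    let e : VilenkinGroup p :=
      ⟨Pi.single (1 - j) 1, 1 - j, fun i hi => Pi.single_eq_of_ne hi.ne _⟩
    have he : ∀ i, e i = (Pi.single (1 - j) 1 : ℤ → ZMod p) i := fun _ => rfl
    have h1 : chi e ω = 1 := hω e fun i hi => by
      rw [he]
      exact Pi.single_eq_of_ne (by omega) _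
    have h2 : ∑ᶠ i : ℤ, e i * ω (1 - i) = ω j := by
      rw [finsum_eq_single _ (1 - j)]
      · simp [he]
      · intro i hi
        rw [he, Pi.single_eq_of_ne hi, zero_mul]
    rw [chi, h2] at h1
    exact ZMod.injective_stdAddChar (h1.trans (AddChar.map_zero_eq_one _).symm)
  · intro hω h hh
    have : (fun j : ℤ => h j * ω (1 - j)) = fun _ => 0 := by
      funext j
      rcases lt_or_ge 0 j with hj | hj
      · simp [hh j hj]
      · simp [hω (1 - j) (by omega)]
    rw [chi, this, finsum_zero, AddChar.map_zero_eq_one]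

/-! ### Translations, the Fourier transform and the bracket -/

variable {p} [NeZero p]

/-- The translation `(T_h f)(x) = f(x - h)` on `L²(G)`. -/
noncomputable def translate (h : VilenkinGroup p) (f : L2 p) : L2 p :=
  Lp.compMeasurePreserving (fun x => x - h) (measurePreserving_sub_right (haar p) h) f

/-- The Fourier integral `ω ↦ ∫_G f(x) conj(χ(x, ω)) dμ(x)`. -/
noncomputable def fourierIntegral (f : VilenkinGroup p → ℂ) (ω : VilenkinGroup p) : ℂ :=
  ∫ x, f x * conj (chi x ω) ∂(haar p)

/-- `F` is a continuous linear operator `L²(G) → L²(G*)` that is given by the Fourier integral on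
`L¹(G) ∩ L²(G)`. As `L¹ ∩ L²` is dense in `L²`, at most one operator has this property; by
Plancherel's theorem there is one. -/
def IsFourierTransform (F : L2 p →L[ℂ] L2 p) : Prop :=
  ∀ f : L2 p, Integrable (fun x => f x) (haar p) →
    (fun ω => F f ω) =ᵐ[haar p] fourierIntegral (fun x => f x)

variable (p) in
open Classical in
/-- The Fourier transform `f ↦ f̂` from `L²(G)` to `L²(G*)`: the continuous extension of the Fourier
integral from `L¹(G) ∩ L²(G)`. -/
noncomputable def fourier : L2 p →L[ℂ] L2 p :=
  if h : ∃ F : L2 p →L[ℂ] L2 p, IsFourierTransform F then h.choose else 0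

/-- The bracket `[f, g](ω) = ∑_{h ∈ H^⊥} f(ω + h) conj(g(ω + h))` on `G*`. -/
noncomputable def bracket (f g : VilenkinGroup p → ℂ) (ω : VilenkinGroup p) : ℂ :=
  ∑' h : Hperp p, f (ω + h) * conj (g (ω + h))

/-- `[f, f]` is the (real) periodization function `∑_{h ∈ H^⊥} |f(ω + h)|²`. -/
theorem bracket_self (f : VilenkinGroup p → ℂ) (ω : VilenkinGroup p) :
    bracket f f ω = ((∑' h : Hperp p, ‖f (ω + h)‖ ^ 2 : ℝ) : ℂ) := by
  simp [bracket, Complex.mul_conj, Complex.normSq_eq_norm_sq, Complex.ofReal_tsum]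

/-- `N_φ = {ω ∈ U* : [φ̂, φ̂](ω) = 0}`. -/
def zeroSet (φ : L2 p) : Set (VilenkinGroup p) :=
  {ω | ω ∈ U p 0 ∧ bracket (fourier p φ) (fourier p φ) ω = 0}

end Vilenkin

/-!
The proof turns the translates of `φ` into exponentials with a weight.

The group `G` is the disjoint union of the cosets `h + U`, `h ∈ H`, of the compact open subgroup
`U` (`isAddFundamentalDomain_U`), and the characters `u ↦ conj(χ(h, u))`, `h ∈ H`, form a Hilbert
basis of `L²(U)` (`basisU`; completeness is the Stone–Weierstrass theorem). Their copies on the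
cosets form a Hilbert basis of `L²(G)` indexed by `H × H` (`basisG`). Since `H^⊥` and `U^⊥` are the
groups `H` and `U` again, the Fourier integral permutes this basis by `(h, k) ↦ (-k, h)`, so that
the unitary operator with this effect is the Fourier transform (`isFourierTransform_plancherel`,
`fourier_apply`). On a coset of `U*`, the Fourier integral of an integrable function is an absolutely
convergent series of characters, which is how the two are compared.

Hence, if `∑ c_h T_h φ` converges, its transform on each coset `k + U*` is `m_c · φ̂(k + ·)`, with
`m_c ∈ L²(U*)` the Fourier series with coefficients `c` (`cosetRestrict_fourier_of_hasSum`). Summing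
over the cosets gives `‖∑ c_h T_h φ‖² = ∫_{U*} |m_c|² w`, where `w = [φ̂, φ̂]`
(`hasWeight_translate`).

What is left is a statement about weights (`HasWeight`). The kernel of the synthesis operator
consists of the `c` with `m_c = 0` almost everywhere on `{w ≠ 0}`, and its orthogonal complement of
the `c` with `m_c = 0` almost everywhere on `{w = 0}`. If `C ≤ w ≤ D` on `{w ≠ 0}`, the frame
inequalities follow by integration. Conversely, the frame inequalities for `m_c = 1_A`, with
`A ⊆ {w ≠ 0}` measurable, say that `C μ(A) ≤ ∫_A w ≤ D μ(A)`.
-/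

/-! ### Characters and topology of the Vilenkin group -/

namespace Vilenkin

variable {p : ℕ}

section Characters

variable [NeZero p]

theorem chi_add_right (x ω ω' : VilenkinGroup p) : chi x (ω + ω') = chi x ω * chi x ω' := by
  have hs : ∀ ω : VilenkinGroup p, (Function.support fun j : ℤ => x j * ω (1 - j)).Finite :=
    fun ω => (finite_support x ω).subset fun j hj =>
      ⟨left_ne_zero_of_mul hj, right_ne_zero_of_mul hj⟩
  rw [chi, chi, chi, ← AddChar.map_add_eq_mul, ← finsum_add_distrib (hs ω) (hs ω')]
  simp [mul_add]

theorem chi_comm (x ω : VilenkinGroup p) : chi x ω = chi ω x := by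
  rw [chi, chi, ← finsum_comp_equiv (Equiv.subLeft (1 : ℤ))]
  simp [mul_comm]

theorem chi_add_left (x y ω : VilenkinGroup p) : chi (x + y) ω = chi x ω * chi y ω := by
  simp only [chi_comm _ ω, chi_add_right]

@[simp] theorem chi_zero_left (ω : VilenkinGroup p) : chi 0 ω = 1 := by
  simp [chi]

@[simp] theorem norm_chi (x ω : VilenkinGroup p) : ‖chi x ω‖ = 1 := by
  simp [chi]

@[simp] theorem conj_chi (x ω : VilenkinGroup p) : conj (chi x ω) = chi (-x) ω := by
  have h : chi x ω * chi (-x) ω = 1 := by rw [← chi_add_left, add_neg_cancel, chi_zero_left]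
  rw [eq_inv_of_mul_eq_one_right h, Complex.inv_eq_conj (norm_chi x ω)]

theorem chi_eq_one_of_mem_U {x ω : VilenkinGroup p} (hx : x ∈ U p 0) (hω : ω ∈ U p 0) :
    chi x ω = 1 := by
  have : (fun j : ℤ => x j * ω (1 - j)) = fun _ => 0 := by
    funext j
    rcases le_or_gt j 0 with hj | hj
    · simp [hx j hj]
    · simp [hω (1 - j) (by omega)]
  rw [chi, this, finsum_zero, AddChar.map_zero_eq_one]

theorem chi_eq_one_of_mem_H {h k : VilenkinGroup p} (hh : h ∈ H p) (hk : k ∈ H p) :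
    chi h k = 1 :=
  (mem_Hperp_iff (ω := k)).2 hk h hh

theorem continuous_chi (x : VilenkinGroup p) : Continuous (chi x) := by
  obtain ⟨k, hk⟩ := exists_zero x
  refine continuous_iff_continuousAt.2 fun ω => ?_
  refine tendsto_nhds_of_eventually_eq ((hasBasis_nhds ω).eventually_iff.2
    ⟨1 - k, trivial, fun ω' hω' => ?_⟩)
  have h1 : chi x (ω' - ω) = 1 := by
    have : (fun j : ℤ => x j * (ω' - ω) (1 - j)) = fun _ => 0 := by
      funext j
      rcases lt_or_ge j k with hj | hj
      · simp [hk j hj]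
      · rw [hω' (1 - j) (by omega), mul_zero]
    rw [chi, this, finsum_zero, AddChar.map_zero_eq_one]
  rw [← sub_add_cancel ω' ω, chi_add_right, h1, one_mul]

/-- A nonzero element of `H` is a nontrivial character of `U`: this makes the characters with
index in `H` orthogonal. -/
theorem exists_mem_U_chi_ne_one {h : VilenkinGroup p} (hh : h ∈ H p) (h0 : h ≠ 0) :
    ∃ u ∈ U p 0, chi h u ≠ 1 := by
  by_contra! hc
  refine h0 (ext fun j => ?_)
  rcases lt_or_ge 0 j with hj | hj
  · exact hh j hj
  let e : VilenkinGroup p :=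
    ⟨Pi.single (1 - j) 1, 1 - j, fun i hi => Pi.single_eq_of_ne hi.ne _⟩
  have he : ∀ i, e i = (Pi.single (1 - j) 1 : ℤ → ZMod p) i := fun _ => rfl
  have h1 : chi h e = 1 := hc e fun i hi => by
    rw [he]
    exact Pi.single_eq_of_ne (by omega) _
  have h2 : ∑ᶠ i : ℤ, h i * e (1 - i) = h j := by
    rw [finsum_eq_single _ j]
    · simp [he]
    · intro i hi
      rw [he, Pi.single_eq_of_ne (by omega), mul_zero]
  rw [chi, h2] at h1
  exact ZMod.injective_stdAddChar (h1.trans (AddChar.map_zero_eq_one _).symm)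

/-- The characters of `H` separate the points of `U`. -/
theorem exists_mem_H_chi_ne_one {u : VilenkinGroup p} (hu : u ∈ U p 0) (h0 : u ≠ 0) :
    ∃ h ∈ H p, chi h u ≠ 1 := by
  by_contra! hc
  refine h0 (ext fun j => ?_)
  rcases le_or_gt j 0 with hj | hj
  · exact hu j hj
  · exact mem_Hperp_iff.1 hc j hj

end Characters

section Topology

variable (p) in
/-- The sequences `x ∈ G` with `x_j = 0` for all large `j`. -/
def finitelySupported : Set (VilenkinGroup p) := {x | ∃ l : ℤ, ∀ j > l, x j = 0}

variable (p) in
theorem countable_finitelySupported [NeZero p] : (finitelySupported p).Countable := by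
  have hf : ∀ x : finitelySupported p, (Function.support (x : VilenkinGroup p)).Finite := by
    rintro ⟨x, l, hl⟩
    obtain ⟨k, hk⟩ := exists_zero x
    exact (Set.finite_Icc k l).subset fun j hj =>
      ⟨not_lt.1 fun h => hj (hk j h), not_lt.1 fun h => hj (hl j h)⟩
  have hi : Function.Injective fun x : finitelySupported p =>
      Finsupp.ofSupportFinite (x : VilenkinGroup p) (hf x) := fun x y hxy =>
    Subtype.ext (ext fun j => DFunLike.congr_fun hxy j)
  exact hi.countable

instance [NeZero p] : Countable (H p) :=
  ((countable_finitelySupported p).mono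
    (fun _ hx => ⟨0, hx⟩ : (H p : Set (VilenkinGroup p)) ⊆ finitelySupported p)).to_subtype

instance [NeZero p] : SecondCountableTopology (VilenkinGroup p) := by
  have := (countable_finitelySupported p).to_subtype
  refine (TopologicalSpace.isTopologicalBasis_of_isOpen_of_nhds
    (s := Set.range fun q : ℤ × finitelySupported p => {y | y - (q.2 : VilenkinGroup p) ∈ U p q.1})
    ?_ ?_).secondCountableTopology (Set.countable_range _)
  · rintro _ ⟨q, rfl⟩
    exact isOpen_coset _ _
  · intro x s hx hs
    obtain ⟨l, hl⟩ := isOpen_iff.1 hs x hx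
    obtain ⟨k, hk⟩ := exists_zero x
    let y : VilenkinGroup p := ⟨fun j => if j ≤ l then x j else 0, k, fun j hj => by simp [hk j hj]⟩
    have hy : ∀ j ≤ l, y j = x j := fun j hj => if_pos hj
    refine ⟨_, ⟨(l, ⟨y, l, fun j hj => if_neg (not_le.2 hj)⟩), rfl⟩, ?_, ?_⟩
    · intro j hj
      simp [hy j hj]
    · intro z hz
      rw [← add_sub_cancel x z]
      refine hl _ fun j hj => ?_
      have := hz j hj
      rw [sub_apply, hy j hj] at this
      rwa [sub_apply]

end Topology

variable (p) in
/-- Every element of `G` is uniquely the sum of an element of `H` and an element of `U`. -/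
theorem isAddFundamentalDomain_U [NeZero p] :
    IsAddFundamentalDomain (H p) (U p 0 : Set (VilenkinGroup p)) (haar p) := by
  refine .mk' (isOpen_U 0).measurableSet.nullMeasurableSet fun x => ?_
  obtain ⟨k, hk⟩ := exists_zero x
  let y : VilenkinGroup p := ⟨fun j => if j ≤ 0 then x j else 0, k, fun j hj => by simp [hk j hj]⟩
  have hy : ∀ j ≤ 0, y j = x j := fun j hj => if_pos hj
  refine ⟨-⟨y, fun j hj => if_neg (not_le.2 hj)⟩, ?_, ?_⟩
  · intro j hj
    change (-y + x) j = 0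
    simp [hy j hj]
  · rintro ⟨h, hh⟩ hx
    refine Subtype.ext (ext fun j => ?_)
    change h j = (-y) j
    rcases le_or_gt j 0 with hj | hj
    · have : (h + x) j = 0 := hx j hj
      rw [add_apply] at this
      rw [neg_apply, hy j hj, eq_neg_of_add_eq_zero_left this]
    · rw [hh j hj, neg_apply, show y j = 0 from if_neg (not_le.2 hj), neg_zero]

end Vilenkin

theorem enorm_sq_eq_lintegral_enorm_sq {α : Type*} {_ : MeasurableSpace α} {ν : Measure α}
    (f : Lp ℂ 2 ν) : ‖f‖ₑ ^ 2 = ∫⁻ x, ‖f x‖ₑ ^ 2 ∂ν := by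
  rw [Lp.enorm_def]
  simpa using eLpNorm_nnreal_pow_eq_lintegral (μ := ν) (f := f) (p := 2) two_ne_zero

namespace Vilenkin

/-! ### Fourier series on the compact group `U` -/

section FourierSeries

variable (p : ℕ)

theorem measurableSet_U : MeasurableSet (U p 0 : Set (VilenkinGroup p)) :=
  (isOpen_U 0).measurableSet

variable [NeZero p]

/-- The restriction of the Haar measure of `G` to `U`, as a measure on the type `U`. -/
noncomputable def haarU : Measure (U p 0) := (haar p).comap Subtype.val

theorem measurePreserving_val :
    MeasurePreserving (Subtype.val : U p 0 → VilenkinGroup p) (haarU p)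
      ((haar p).restrict (U p 0 : Set (VilenkinGroup p))) :=
  measurePreserving_subtype_coe (measurableSet_U p)

instance : IsProbabilityMeasure (haarU p) :=
  ⟨by rw [← Set.preimage_univ (f := (Subtype.val : U p 0 → VilenkinGroup p)),
    (measurePreserving_val p).measure_preimage MeasurableSet.univ.nullMeasurableSet,
    Measure.restrict_apply_univ, haar_U]⟩

instance : CompactSpace (U p 0) := isCompact_iff_compactSpace.1 (isCompact_U p 0)

variable {p}

/-- The character `u ↦ conj(χ(x, u))` of `U`. -/
noncomputable def charU (x : VilenkinGroup p) : C(U p 0, ℂ) :=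
  ⟨fun u => conj (chi x u),
    Complex.continuous_conj.comp ((continuous_chi x).comp continuous_subtype_val)⟩

theorem charU_apply (x : VilenkinGroup p) (u : U p 0) : charU x u = conj (chi x u) := rfl

theorem charU_add (x y : VilenkinGroup p) : charU (x + y) = charU x * charU y := by
  ext u
  simp only [ContinuousMap.mul_apply, charU_apply, chi_add_left, map_mul]

theorem charU_zero : charU (0 : VilenkinGroup p) = 1 := by
  ext u
  simp [charU_apply]

theorem star_charU (x : VilenkinGroup p) : star (charU x) = charU (-x) := by
  ext u
  simp [charU_apply]

@[simp] theorem norm_charU_apply (x : VilenkinGroup p) (u : U p 0) : ‖charU x u‖ = 1 := by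
  rw [charU_apply, RCLike.norm_conj, norm_chi]

theorem integral_charU {h : VilenkinGroup p} (hh : h ∈ H p) (h0 : h ≠ 0) :
    ∫ u, charU h u ∂(haarU p) = 0 := by
  obtain ⟨v, hv, hv1⟩ := exists_mem_U_chi_ne_one hh h0
  -- The integral is unchanged by the translation by `v`, which multiplies it by a number `≠ 1`.
  set g : VilenkinGroup p → ℂ :=
    (U p 0 : Set (VilenkinGroup p)).indicator fun x => conj (chi h x) with hg
  have h1 : ∫ u, charU h u ∂(haarU p) = ∫ x, g x ∂(haar p) := by
    rw [hg, integral_indicator (measurableSet_U p)]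
    exact integral_subtype_comap (measurableSet_U p) fun x => conj (chi h x)
  have h2 : ∀ x, g (v + x) = conj (chi h v) * g x := by
    intro x
    have : v + x ∈ U p 0 ↔ x ∈ U p 0 := (U p 0).add_mem_cancel_left hv
    by_cases hx : x ∈ U p 0
    · rw [hg, Set.indicator_of_mem (this.2 hx), Set.indicator_of_mem hx, chi_add_right, map_mul]
    · rw [hg, Set.indicator_of_notMem (fun h => hx (this.1 h)), Set.indicator_of_notMem hx,
        mul_zero]
  have h3 := integral_add_left_eq_self (μ := haar p) g v
  simp only [h2, integral_const_mul] at h3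
  rw [h1]
  by_contra hne
  have h4 : conj (chi h v) = 1 := mul_right_cancel₀ hne (h3.trans (one_mul _).symm)
  exact hv1 (by rw [← Complex.conj_conj (chi h v), h4, map_one])

theorem orthonormal_charU :
    Orthonormal ℂ fun h : H p =>
      ContinuousMap.toLp (E := ℂ) 2 (haarU p) ℂ (charU (h : VilenkinGroup p)) := by
  classical
  rw [orthonormal_iff_ite]
  intro h k
  rw [ContinuousMap.inner_toLp]
  have : ∀ u : U p 0, charU (k : VilenkinGroup p) u * conj (charU (h : VilenkinGroup p) u) =
      charU ((k : VilenkinGroup p) - (h : VilenkinGroup p)) u := fun u => by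
    rw [sub_eq_add_neg, charU_add, ← star_charU]
    rfl
  simp only [this]
  split_ifs with hhk
  · subst hhk
    simp [charU_zero]
  · exact integral_charU ((H p).sub_mem k.2 h.2)
      (sub_ne_zero.2 fun he => hhk (Subtype.ext he.symm))

/-- By the Stone–Weierstrass theorem, the characters `charU h`, `h ∈ H`, span a dense subspace of
`C(U)`. -/
theorem span_charU_topologicalClosure :
    (Submodule.span ℂ (Set.range fun h : H p =>
      charU (h : VilenkinGroup p))).topologicalClosure = ⊤ := by
  set S := Set.range fun h : H p => charU (h : VilenkinGroup p) with hS
  let A : StarSubalgebra ℂ C(U p 0, ℂ) :=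
    { toSubalgebra := Algebra.adjoin ℂ S
      star_mem' := by
        change Algebra.adjoin ℂ S ≤ star (Algebra.adjoin ℂ S)
        refine Algebra.adjoin_le ?_
        rintro - ⟨h, rfl⟩
        exact Algebra.subset_adjoin ⟨-h, (star_charU _).symm⟩ }
  have hA : Subalgebra.toSubmodule A.toSubalgebra = Submodule.span ℂ S := by
    apply Algebra.adjoin_eq_span_of_subset
    refine Set.Subset.trans ?_ Submodule.subset_span
    intro x hx
    refine Submonoid.closure_induction (fun _ => id) ⟨0, charU_zero⟩ ?_ hx
    rintro - - - - ⟨m, rfl⟩ ⟨n, rfl⟩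
    exact ⟨m + n, charU_add _ _⟩
  have hsep : A.SeparatesPoints := by
    intro u v huv
    have h0 : (u : VilenkinGroup p) - v ≠ 0 := sub_ne_zero.2 fun h => huv (Subtype.ext h)
    obtain ⟨h, hh, h1⟩ := exists_mem_H_chi_ne_one ((U p 0).sub_mem u.2 v.2) h0
    refine ⟨_, ⟨charU h, Algebra.subset_adjoin ⟨⟨h, hh⟩, rfl⟩, rfl⟩, fun he => h1 ?_⟩
    have he' : chi h (u : VilenkinGroup p) = chi h v := (starRingEnd ℂ).injective he
    have h2 : chi h (u : VilenkinGroup p) = chi h (u - v : VilenkinGroup p) * chi h v := by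
      rw [← chi_add_right, sub_add_cancel]
    have h3 : chi h (v : VilenkinGroup p) ≠ 0 := norm_ne_zero_iff.1 (by simp)
    exact mul_right_cancel₀ h3 (by rw [← h2, he', one_mul])
  rw [← hA]
  exact congr_arg (Subalgebra.toSubmodule <| StarSubalgebra.toSubalgebra ·)
    (ContinuousMap.starSubalgebra_topologicalClosure_eq_top_of_separatesPoints A hsep)

variable (p) in
/-- The Hilbert basis of `L²(U)` that consists of the characters `u ↦ conj(χ(h, u))`, `h ∈ H`. -/
noncomputable def basisU : HilbertBasis (H p) ℂ (Lp ℂ 2 (haarU p)) :=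
  HilbertBasis.mk orthonormal_charU (by
    have : SecondCountableTopology (U p 0) :=
      TopologicalSpace.Subtype.secondCountableTopology (U p 0 : Set (VilenkinGroup p))
    have := (ContinuousMap.toLp_denseRange ℂ (haarU p) ℂ
      (p := 2) ENNReal.ofNat_ne_top).topologicalClosure_map_submodule span_charU_topologicalClosure
    rw [Submodule.map_span, ← Set.range_comp] at this
    exact this.ge)

theorem basisU_apply (h : H p) :
    basisU p h = ContinuousMap.toLp (E := ℂ) 2 (haarU p) ℂ (charU (h : VilenkinGroup p)) :=
  congr_fun (HilbertBasis.coe_mk _ _) h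

theorem coeFn_basisU (h : H p) :
    basisU p h =ᵐ[haarU p] charU (h : VilenkinGroup p) := by
  rw [basisU_apply]
  exact ContinuousMap.coeFn_toLp _ _

theorem inner_basisU (h : H p) (f : Lp ℂ 2 (haarU p)) :
    inner ℂ (basisU p h) f = ∫ u : U p 0, chi (h : VilenkinGroup p) u * f u ∂(haarU p) := by
  rw [L2.inner_def]
  refine integral_congr_ae ?_
  filter_upwards [coeFn_basisU h] with u hu
  rw [hu, RCLike.inner_apply', charU_apply, Complex.conj_conj]

theorem ext_inner_basisU {f g : Lp ℂ 2 (haarU p)}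
    (hfg : ∀ h : H p, (inner ℂ (basisU p h) f : ℂ) = inner ℂ (basisU p h) g) : f = g := by
  refine (basisU p).repr.injective (lp.ext (funext fun h => ?_))
  rw [HilbertBasis.repr_apply_apply, HilbertBasis.repr_apply_apply, hfg]

end FourierSeries

/-! ### The restrictions of a function to the cosets of `U` -/

section Restriction

variable {p : ℕ} [NeZero p]

theorem lintegral_eq_tsum_haarU (f : VilenkinGroup p → ℝ≥0∞) :
    ∫⁻ x, f x ∂(haar p) = ∑' h : H p, ∫⁻ u : U p 0, f (h + u) ∂(haarU p) := by
  rw [(isAddFundamentalDomain_U p).lintegral_eq_tsum'']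
  refine tsum_congr fun h => ?_
  exact (lintegral_subtype_comap (measurableSet_U p) fun x => f (h + x)).symm

theorem integral_eq_tsum_haarU {f : VilenkinGroup p → ℂ} (hf : Integrable f (haar p)) :
    ∫ x, f x ∂(haar p) = ∑' h : H p, ∫ u : U p 0, f (h + u) ∂(haarU p) := by
  rw [(isAddFundamentalDomain_U p).integral_eq_tsum'' f hf]
  refine tsum_congr fun h => ?_
  exact (integral_subtype_comap (measurableSet_U p) fun x => f (h + x)).symm

theorem quasiMeasurePreserving_add_val (h : VilenkinGroup p) :
    Measure.QuasiMeasurePreserving (fun u : U p 0 => h + (u : VilenkinGroup p)) (haarU p) (haar p) :=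
  (measurePreserving_add_left (haar p) h).quasiMeasurePreserving.comp
    ((measurePreserving_val p).quasiMeasurePreserving.mono_right
      Measure.restrict_le_self.absolutelyContinuous)

/-- A property holds almost everywhere in `G` when it does so on each coset `h + U`, `h ∈ H`. -/
theorem ae_haar_of_forall_coset {P : VilenkinGroup p → Prop}
    (hP : ∀ h : H p, ∀ᵐ u : U p 0 ∂(haarU p), P (h + u)) : ∀ᵐ x ∂(haar p), P x := by
  have hP' : ∀ h : H p, ∀ᵐ x ∂(haar p), x ∈ U p 0 → P (h + x) := fun h =>
    (ae_restrict_iff' (measurableSet_U p)).1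
      ((ae_restrict_iff_subtype (measurableSet_U p)).2 (hP h))
  have hQ : ∀ h : H p, ∀ᵐ x ∂(haar p), -(h : VilenkinGroup p) + x ∈ U p 0 → P x := fun h => by
    filter_upwards [(measurePreserving_add_left (haar p)
      (-(h : VilenkinGroup p))).quasiMeasurePreserving.ae (hP' h)] with x hx hxU
    simpa using hx hxU
  filter_upwards [(isAddFundamentalDomain_U p).ae_covers, ae_all_iff.2 hQ] with x ⟨h, hx⟩ hxQ
  refine hxQ (-h) ?_
  change -(-(h : VilenkinGroup p)) + x ∈ U p 0
  rwa [neg_neg]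

/-- The operator `L²(G) → L²(U)` that takes `f` to `u ↦ f(x + u)`. -/
noncomputable def cosetRestrict (x : VilenkinGroup p) : L2 p →L[ℂ] Lp ℂ 2 (haarU p) :=
  (Lp.compMeasurePreservingₗᵢ ℂ Subtype.val (measurePreserving_val p)).toContinuousLinearMap ∘L
    LpToLpRestrictCLM (VilenkinGroup p) ℂ ℂ (haar p) 2 (U p 0 : Set (VilenkinGroup p)) ∘L
    (Lp.compMeasurePreservingₗᵢ ℂ (fun y => x + y)
      (measurePreserving_add_left (haar p) x)).toContinuousLinearMap

theorem coeFn_cosetRestrict (x : VilenkinGroup p) (f : L2 p) :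
    cosetRestrict x f =ᵐ[haarU p] fun u => f (x + u) := by
  have hval : Measure.QuasiMeasurePreserving (Subtype.val : U p 0 → VilenkinGroup p) (haarU p)
      ((haar p).restrict (U p 0 : Set (VilenkinGroup p))) :=
    (measurePreserving_val p).quasiMeasurePreserving
  have h1 := Lp.coeFn_compMeasurePreserving (p := 2) (E := ℂ)
    (LpToLpRestrictCLM (VilenkinGroup p) ℂ ℂ (haar p) 2 (U p 0 : Set (VilenkinGroup p))
      (Lp.compMeasurePreserving (fun y => x + y) (measurePreserving_add_left (haar p) x) f))
    (measurePreserving_val p)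
  have h2 := hval.ae_eq (LpToLpRestrictCLM_coeFn ℂ (U p 0 : Set (VilenkinGroup p))
    (Lp.compMeasurePreserving (fun y => x + y) (measurePreserving_add_left (haar p) x) f))
  have h3 := hval.ae_eq (ae_restrict_of_ae (Lp.coeFn_compMeasurePreserving f
    (measurePreserving_add_left (haar p) x)))
  filter_upwards [h1, h2, h3] with u h1 h2 h3
  exact h1.trans (h2.trans h3)

theorem enorm_sq_eq_tsum (f : L2 p) :
    ‖f‖ₑ ^ 2 = ∑' h : H p, ∫⁻ u : U p 0, ‖f (h + u)‖ₑ ^ 2 ∂(haarU p) := by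
  rw [← lintegral_eq_tsum_haarU fun x => ‖f x‖ₑ ^ 2, enorm_sq_eq_lintegral_enorm_sq]

theorem ext_cosetRestrict {f g : L2 p}
    (hfg : ∀ h : H p, cosetRestrict (h : VilenkinGroup p) f = cosetRestrict h g) : f = g := by
  refine Lp.ext (ae_haar_of_forall_coset fun h => ?_)
  filter_upwards [coeFn_cosetRestrict (h : VilenkinGroup p) f,
    coeFn_cosetRestrict (h : VilenkinGroup p) g] with u hf hg
  rw [← hf, ← hg, hfg]

end Restriction

/-! ### An orthonormal basis of `L²(G)` -/

section Basis

variable {p : ℕ}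

theorem eq_of_coset_eq {h k : H p} {u : VilenkinGroup p} (hu : u ∈ U p 0)
    (hk : (h : VilenkinGroup p) + u - k ∈ U p 0) : h = k := by
  have h1 : (h : VilenkinGroup p) - k ∈ U p 0 := by
    have := (U p 0).sub_mem hk hu
    rwa [show (h : VilenkinGroup p) + u - k - u = h - k by abel] at this
  refine Subtype.ext (sub_eq_zero.1 (ext fun j => ?_))
  rcases le_or_gt j 0 with hj | hj
  · exact h1 j hj
  · exact (H p).sub_mem h.2 k.2 j hj

variable [NeZero p]

theorem inner_eq_tsum_cosetRestrict (f g : L2 p) :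
    inner ℂ f g = ∑' h : H p, (inner ℂ (cosetRestrict h f) (cosetRestrict h g) : ℂ) := by
  rw [L2.inner_def, integral_eq_tsum_haarU (L2.integrable_inner f g)]
  refine tsum_congr fun h => ?_
  rw [L2.inner_def]
  refine integral_congr_ae ?_
  filter_upwards [coeFn_cosetRestrict (h : VilenkinGroup p) f,
    coeFn_cosetRestrict (h : VilenkinGroup p) g] with u hf hg
  rw [hf, hg]

/-- The character `conj(χ(k, ·))` on the coset `h + U`, extended by zero. -/
noncomputable def cosetChar (i : H p × H p) : VilenkinGroup p → ℂ :=
  {x : VilenkinGroup p | x - i.1 ∈ U p 0}.indicator fun x => conj (chi i.2 x)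

theorem memLp_cosetChar (i : H p × H p) (q : ℝ≥0∞) : MemLp (cosetChar i) q (haar p) := by
  have hm : MeasurableSet {x : VilenkinGroup p | x - i.1 ∈ U p 0} :=
    (isOpen_coset (i.1 : VilenkinGroup p) 0).measurableSet
  have : IsFiniteMeasure ((haar p).restrict {x : VilenkinGroup p | x - i.1 ∈ U p 0}) := by
    refine ⟨?_⟩
    rw [Measure.restrict_apply_univ]
    have := (measurePreserving_sub_right (haar p) (i.1 : VilenkinGroup p)).measure_preimage
      (measurableSet_U p).nullMeasurableSet
    rw [haar_U] at this
    exact lt_of_eq_of_lt this ENNReal.one_lt_top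
  refine (memLp_indicator_iff_restrict hm).2 (MemLp.of_bound ?_ 1 (ae_of_all _ fun x => ?_))
  · exact (Complex.continuous_conj.comp (continuous_chi _)).aestronglyMeasurable
  · rw [RCLike.norm_conj, norm_chi]

/-- The class of `cosetChar i` in `L²(G)`. -/
noncomputable def cosetCharLp (i : H p × H p) : L2 p := (memLp_cosetChar i 2).toLp _

theorem coeFn_cosetCharLp (i : H p × H p) : cosetCharLp i =ᵐ[haar p] cosetChar i :=
  MemLp.coeFn_toLp _

theorem cosetRestrict_cosetCharLp_self (h k : H p) :
    cosetRestrict (h : VilenkinGroup p) (cosetCharLp (h, k)) = basisU p k := by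
  refine Lp.ext ?_
  filter_upwards [coeFn_cosetRestrict (h : VilenkinGroup p) (cosetCharLp (h, k)),
    (quasiMeasurePreserving_add_val (h : VilenkinGroup p)).ae (coeFn_cosetCharLp (h, k)),
    coeFn_basisU k] with u h1 h2 h3
  have hu : (h : VilenkinGroup p) + u ∈ {x : VilenkinGroup p | x - h ∈ U p 0} := by
    simp
  rw [h1, h2, h3, cosetChar, Set.indicator_of_mem hu, charU_apply, chi_add_right,
    chi_eq_one_of_mem_H k.2 h.2, one_mul]

theorem cosetRestrict_cosetCharLp_of_ne {j h : H p} (hj : j ≠ h) (k : H p) :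
    cosetRestrict (j : VilenkinGroup p) (cosetCharLp (h, k)) = 0 := by
  refine Lp.ext ?_
  filter_upwards [coeFn_cosetRestrict (j : VilenkinGroup p) (cosetCharLp (h, k)),
    (quasiMeasurePreserving_add_val (j : VilenkinGroup p)).ae (coeFn_cosetCharLp (h, k)),
    Lp.coeFn_zero ℂ 2 (haarU p)] with u h1 h2 h3
  have hu : (j : VilenkinGroup p) + u ∉ {x : VilenkinGroup p | x - h ∈ U p 0} :=
    fun hu => hj (eq_of_coset_eq u.2 hu)
  rw [h1, h2, h3, cosetChar, Set.indicator_of_notMem hu, Pi.zero_apply]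

theorem inner_cosetCharLp (h k : H p) (g : L2 p) :
    (inner ℂ (cosetCharLp (h, k)) g : ℂ) = inner ℂ (basisU p k) (cosetRestrict h g) := by
  rw [inner_eq_tsum_cosetRestrict, tsum_eq_single h, cosetRestrict_cosetCharLp_self]
  intro j hj
  rw [cosetRestrict_cosetCharLp_of_ne hj, inner_zero_left]

theorem orthonormal_cosetCharLp : Orthonormal ℂ (cosetCharLp : H p × H p → L2 p) := by
  classical
  rw [orthonormal_iff_ite]
  rintro ⟨h, k⟩ ⟨h', k'⟩
  rw [inner_cosetCharLp]
  by_cases hh : h = h'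
  · subst hh
    rw [cosetRestrict_cosetCharLp_self, orthonormal_iff_ite.1 (basisU p).orthonormal]
    simp
  · rw [cosetRestrict_cosetCharLp_of_ne hh, inner_zero_right, if_neg fun he => hh (by simp_all)]

variable (p) in
/-- The Hilbert basis of `L²(G)` that consists of the characters `conj(χ(k, ·))` on the cosets
`h + U`, for `(h, k) ∈ H × H`. -/
noncomputable def basisG : HilbertBasis (H p × H p) ℂ (L2 p) :=
  HilbertBasis.mkOfOrthogonalEqBot orthonormal_cosetCharLp (by
    refine (Submodule.eq_bot_iff _).2 fun g hg => ?_
    refine ext_cosetRestrict fun h => ext_inner_basisU fun k => ?_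
    rw [map_zero, inner_zero_right, ← inner_cosetCharLp]
    exact (Submodule.mem_orthogonal _ _).1 hg _ (Submodule.subset_span ⟨(h, k), rfl⟩))

theorem basisG_apply (i : H p × H p) : basisG p i = cosetCharLp i :=
  congr_fun (HilbertBasis.coe_mkOfOrthogonalEqBot _ _) i

end Basis

/-! ### The Fourier transform on `L²(G)` -/

section Fourier

variable (p : ℕ) [NeZero p]

/-- The quarter turn `(h, k) ↦ (-k, h)` of `H × H`: the Fourier transform moves `basisG` by it. -/
def quarterTurn : H p × H p ≃ H p × H p where
  toFun i := (-i.2, i.1)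
  invFun i := (i.2, -i.1)
  left_inv i := by simp
  right_inv i := by simp

/-- The Hilbert basis `basisG`, enumerated along `quarterTurn`. -/
noncomputable def turnedBasisG : HilbertBasis (H p × H p) ℂ (L2 p) :=
  HilbertBasis.mk ((basisG p).orthonormal.comp _ (quarterTurn p).injective) (by
    rw [(quarterTurn p).surjective.range_comp]
    exact (basisG p).dense_span.ge)

/-- The unitary operator of `L²(G)` that takes the element of `basisG` with index `(h, k)` to the
one with index `(-k, h)`. -/
noncomputable def plancherel : L2 p ≃ₗᵢ[ℂ] L2 p :=
  (basisG p).repr.trans (turnedBasisG p).repr.symm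

variable {p}

/-- In terms of Fourier coefficients on the cosets of `U`, the operator `plancherel` exchanges the
coset and the frequency, up to a sign. -/
theorem inner_cosetRestrict_plancherel (h k : H p) (f : L2 p) :
    (inner ℂ (basisU p h) (cosetRestrict k (plancherel p f)) : ℂ) =
      inner ℂ (basisU p (-k)) (cosetRestrict h f) := by
  have h1 : turnedBasisG p (h, -k) = cosetCharLp (k, h) := by
    rw [turnedBasisG, HilbertBasis.coe_mk, Function.comp_apply, basisG_apply]
    simp [quarterTurn]
  rw [← inner_cosetCharLp, ← inner_cosetCharLp, ← basisG_apply (h, -k), ← h1,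
    ← HilbertBasis.repr_apply_apply, ← HilbertBasis.repr_apply_apply]
  simp [plancherel]

/-- As `χ = 1` on `H × H` and on `U × U`, two of the four factors of `χ(h + u, k + v)` drop out. -/
theorem conj_chi_coset (h k : H p) (u v : U p 0) :
    conj (chi (h + u : VilenkinGroup p) (k + v : VilenkinGroup p)) =
      chi (-(k : VilenkinGroup p)) u * charU (h : VilenkinGroup p) v := by
  rw [chi_add_left, chi_add_right, chi_add_right, chi_eq_one_of_mem_H h.2 k.2,
    chi_eq_one_of_mem_U u.2 v.2, one_mul, mul_one, map_mul, mul_comm, charU_apply, chi_comm u.1,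
    conj_chi k.1]

/-- On the coset `k + U*`, the Fourier integral of `f` is a series of characters; these are its
coefficients. -/
theorem integral_coset_eq_inner (f : L2 p) (h k : H p) :
    ∫ u : U p 0, f (h + u) * chi (-(k : VilenkinGroup p)) u ∂(haarU p) =
      inner ℂ (basisU p (-k)) (cosetRestrict h f) := by
  rw [inner_basisU]
  refine integral_congr_ae ?_
  filter_upwards [coeFn_cosetRestrict (h : VilenkinGroup p) f] with u hu
  rw [hu, mul_comm]
  rfl

theorem summable_norm_inner {f : L2 p} (hf : Integrable (fun x => f x) (haar p)) (k : H p) :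
    Summable fun h : H p => ‖(inner ℂ (basisU p (-k)) (cosetRestrict h f) : ℂ)‖ := by
  have h1 : ∑' h : H p, ‖(inner ℂ (basisU p (-k)) (cosetRestrict h f) : ℂ)‖ₑ ≠ ∞ := by
    refine ne_top_of_le_ne_top hf.2.ne ?_
    rw [lintegral_eq_tsum_haarU]
    refine ENNReal.tsum_le_tsum fun h => ?_
    rw [← integral_coset_eq_inner]
    refine (enorm_integral_le_lintegral_enorm _).trans (lintegral_mono fun u => ?_)
    rw [enorm_mul, ← ofReal_norm (chi _ _), norm_chi, ENNReal.ofReal_one, mul_one]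
  simpa using ENNReal.summable_toReal h1

theorem isFourierTransform_plancherel :
    IsFourierTransform ((plancherel p).toContinuousLinearEquiv : L2 p →L[ℂ] L2 p) := by
  intro f hf
  refine ae_haar_of_forall_coset fun k => ?_
  set a : H p → ℂ := fun h => inner ℂ (basisU p (-k)) (cosetRestrict h f) with ha
  -- On the coset `k + U` both sides have the Fourier series `∑ a_h conj(χ(h, ·))`, which
  -- converges absolutely.
  have hsum : Summable fun h : H p => a h • charU (h : VilenkinGroup p) := by
    refine .of_norm_bounded (summable_norm_inner hf k) fun h => ?_
    rw [norm_smul]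
    refine mul_le_of_le_one_right (norm_nonneg _) ?_
    exact (ContinuousMap.norm_le _ zero_le_one).2 fun u => (norm_charU_apply _ u).le
  obtain ⟨s, hs⟩ := hsum
  have h1 : cosetRestrict (k : VilenkinGroup p) (plancherel p f) =
      ContinuousMap.toLp (E := ℂ) 2 (haarU p) ℂ s := by
    have h2 := (basisU p).hasSum_repr (cosetRestrict (k : VilenkinGroup p) (plancherel p f))
    have h3 := hs.mapL (ContinuousMap.toLp (E := ℂ) 2 (haarU p) ℂ)
    refine h2.unique (h3.congr_fun fun h => ?_)
    rw [HilbertBasis.repr_apply_apply, inner_cosetRestrict_plancherel, map_smul,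
      basisU_apply h]
  have h4 : ∀ v : U p 0, fourierIntegral (fun x => f x) (k + v) = s v := by
    intro v
    have hint : Integrable (fun x => f x * conj (chi x (k + v : VilenkinGroup p))) (haar p) := by
      refine hf.mul_bdd (c := 1) ?_ (ae_of_all _ fun x => ?_)
      · simp only [chi_comm _ (k + v : VilenkinGroup p)]
        exact (Complex.continuous_conj.comp (continuous_chi _)).aestronglyMeasurable
      · rw [RCLike.norm_conj, norm_chi]
    have h5 : HasSum (fun h : H p => a h * charU (h : VilenkinGroup p) v) (s v) :=
      hs.mapL (ContinuousMap.evalCLM ℂ v)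
    rw [fourierIntegral, integral_eq_tsum_haarU hint, ← h5.tsum_eq]
    refine tsum_congr fun h => ?_
    change _ = (inner ℂ (basisU p (-k)) (cosetRestrict h f) : ℂ) * _
    rw [← integral_coset_eq_inner, ← integral_mul_const]
    simp only [conj_chi_coset, mul_assoc]
  filter_upwards [coeFn_cosetRestrict (k : VilenkinGroup p) (plancherel p f),
    ContinuousMap.coeFn_toLp (p := 2) (𝕜 := ℂ) (haarU p) s] with v h6 h7
  rw [h4, ← h7, ← h1, h6]
  rfl

/-- Two such operators agree on the elements of `basisG`, which are integrable. -/
theorem IsFourierTransform.unique {F F' : L2 p →L[ℂ] L2 p} (hF : IsFourierTransform F)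
    (hF' : IsFourierTransform F') : F = F' := by
  refine ContinuousLinearMap.ext_on (s := Set.range (basisG p))
    (Submodule.dense_iff_topologicalClosure_eq_top.2 (basisG p).dense_span) ?_
  rintro - ⟨i, rfl⟩
  have hi : Integrable (fun x => basisG p i x) (haar p) := by
    rw [basisG_apply]
    exact (integrable_congr (coeFn_cosetCharLp i)).2
      (memLp_one_iff_integrable.1 (memLp_cosetChar i 1))
  exact Lp.ext ((hF _ hi).trans (hF' _ hi).symm)

/-- The operator that `fourier` chooses is `plancherel`; in particular it is not the default `0`. -/
theorem fourier_apply (f : L2 p) : fourier p f = plancherel p f := by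
  have hex : ∃ F : L2 p →L[ℂ] L2 p, IsFourierTransform F := ⟨_, isFourierTransform_plancherel⟩
  have h1 : IsFourierTransform (fourier p) := by
    rw [fourier, dif_pos hex]
    exact hex.choose_spec
  rw [h1.unique isFourierTransform_plancherel]
  rfl

theorem enorm_fourier (f : L2 p) : ‖fourier p f‖ₑ = ‖f‖ₑ := by
  rw [fourier_apply, ← ofReal_norm, LinearIsometryEquiv.norm_map, ofReal_norm]

theorem inner_cosetRestrict_fourier (h k : H p) (f : L2 p) :
    (inner ℂ (basisU p h) (cosetRestrict k (fourier p f)) : ℂ) =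
      inner ℂ (basisU p (-k)) (cosetRestrict h f) := by
  rw [fourier_apply, inner_cosetRestrict_plancherel]

end Fourier

/-! ### Translations -/

section Translation

variable {p : ℕ} [NeZero p]

theorem cosetRestrict_translate (j h : VilenkinGroup p) (f : L2 p) :
    cosetRestrict j (translate h f) = cosetRestrict (j - h) f := by
  refine Lp.ext ?_
  filter_upwards [coeFn_cosetRestrict j (translate h f), coeFn_cosetRestrict (j - h) f,
    (quasiMeasurePreserving_add_val j).ae (Lp.coeFn_compMeasurePreserving f
      (measurePreserving_sub_right (haar p) h))] with u h1 h2 h3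
  rw [h1, h2, translate, h3, Function.comp_apply]
  congr 1
  abel

/-- The Fourier transform turns the translation by `h` into the multiplication by
`conj(χ(h, ·))`, which on each coset of `U*` is the character `charU h`. -/
theorem cosetRestrict_fourier_translate (k h : H p) (f : L2 p) :
    cosetRestrict k (fourier p (translate h f)) =ᵐ[haarU p]
      fun u => charU (h : VilenkinGroup p) u * cosetRestrict k (fourier p f) u := by
  set ψ := cosetRestrict k (fourier p f) with hψ
  have hm : MemLp (fun u => charU (h : VilenkinGroup p) u * ψ u) 2 (haarU p) :=
    (Lp.memLp ψ).of_le ((charU _).continuous.aestronglyMeasurable.mul (Lp.aestronglyMeasurable ψ))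
      (ae_of_all _ fun u => by rw [norm_mul, norm_charU_apply, one_mul])
  have : cosetRestrict k (fourier p (translate h f)) = hm.toLp _ := by
    refine ext_inner_basisU fun j => ?_
    rw [inner_cosetRestrict_fourier, cosetRestrict_translate,
      show (j : VilenkinGroup p) - h = ((j - h : H p) : VilenkinGroup p) from rfl,
      ← inner_cosetRestrict_fourier, inner_basisU, inner_basisU]
    refine integral_congr_ae ?_
    filter_upwards [hm.coeFn_toLp] with u hu
    rw [hu, charU_apply, conj_chi, ← mul_assoc, ← chi_add_left, ← sub_eq_add_neg]
    rfl
  rw [this]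
  exact hm.coeFn_toLp

end Translation

end Vilenkin

/-! ### Frame sequences of weighted exponentials -/

section WeightedFrame

theorem ofReal_mul_enorm_sq_le_iff {E F : Type*} [NormedAddCommGroup E]
    [NormedAddCommGroup F] {a b : ℝ} (ha : 0 ≤ a)
    (hb : 0 ≤ b) (x : E) (y : F) :
    ENNReal.ofReal a * ‖x‖ₑ ^ 2 ≤ ENNReal.ofReal b * ‖y‖ₑ ^ 2 ↔ a * ‖x‖ ^ 2 ≤ b * ‖y‖ ^ 2 := by
  rw [← ofReal_norm, ← ofReal_norm, ← ENNReal.ofReal_pow (norm_nonneg _),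
    ← ENNReal.ofReal_pow (norm_nonneg _), ← ENNReal.ofReal_mul ha, ← ENNReal.ofReal_mul hb,
    ENNReal.ofReal_le_ofReal_iff (by positivity)]

variable {α ι E : Type*} [MeasurableSpace α] {ν : Measure α}
  [NormedAddCommGroup E] [InnerProductSpace ℂ E]

theorem enorm_repr_symm (b : HilbertBasis ι ℂ (Lp ℂ 2 ν)) (c : lp (fun _ : ι => ℂ) 2) :
    ‖b.repr.symm c‖ₑ = ‖c‖ₑ := by
  rw [← ofReal_norm, LinearIsometryEquiv.norm_map, ofReal_norm]

/-- `f` behaves like the basis `b` with respect to the measure `w dν`: whenever the series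
`∑ c_j f_j` converges, its norm is that of `∑ c_j b_j` in `L²(w dν)`. -/
def HasWeight (f : ι → E) (b : HilbertBasis ι ℂ (Lp ℂ 2 ν)) (w : α → ℝ≥0∞) : Prop :=
  ∀ (c : lp (fun _ : ι => ℂ) 2) (v : E), HasSum (fun j => c j • f j) v →
    ‖v‖ₑ ^ 2 = ∫⁻ x, ‖b.repr.symm c x‖ₑ ^ 2 * w x ∂ν

variable {f : ι → E} {b : HilbertBasis ι ℂ (Lp ℂ 2 ν)} {w : α → ℝ≥0∞} {C D : ℝ}

theorem HasWeight.enorm_synthesis_sq (h : HasWeight f b w) (hf : SynthesisWellDefined f)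
    (c : lp (fun _ : ι => ℂ) 2) :
    ‖synthesis f hf c‖ₑ ^ 2 = ∫⁻ x, ‖b.repr.symm c x‖ₑ ^ 2 * w x ∂ν :=
  h c _ (hf c).hasSum

theorem HasWeight.mem_ker_synthesis_iff (h : HasWeight f b w) (hw : Measurable w)
    (hf : SynthesisWellDefined f) {c : lp (fun _ : ι => ℂ) 2} :
    c ∈ LinearMap.ker (synthesis f hf) ↔ ∀ᵐ x ∂ν, w x ≠ 0 → b.repr.symm c x = 0 := by
  have hm : AEMeasurable (fun x => ‖b.repr.symm c x‖ₑ ^ 2 * w x) ν :=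
    ((Lp.aestronglyMeasurable _).enorm.pow_const 2).mul hw.aemeasurable
  rw [LinearMap.mem_ker, ← enorm_eq_zero, ← pow_eq_zero_iff two_ne_zero,
    h.enorm_synthesis_sq, lintegral_eq_zero_iff' hm]
  refine eventually_congr (ae_of_all _ fun x => ?_)
  simp only [Pi.zero_apply, mul_eq_zero, pow_eq_zero_iff two_ne_zero, enorm_eq_zero]
  tauto

/-- The indicator of a set where the weight does not vanish is the symbol of a sequence
orthogonal to the kernel. -/
theorem HasWeight.repr_indicator_mem_orthogonal [IsFiniteMeasure ν] (h : HasWeight f b w)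
    (hw : Measurable w) (hf : SynthesisWellDefined f) {A : Set α} (hA : MeasurableSet A)
    (hAw : ∀ x ∈ A, w x ≠ 0) :
    b.repr (indicatorConstLp 2 hA (measure_ne_top ν A) (1 : ℂ)) ∈
      (LinearMap.ker (synthesis f hf))ᗮ := by
  refine (Submodule.mem_orthogonal _ _).2 fun d hd => ?_
  rw [← LinearIsometryEquiv.apply_symm_apply b.repr d, LinearIsometryEquiv.inner_map_map,
    L2.inner_def]
  refine integral_eq_zero_of_ae ?_
  filter_upwards [(h.mem_ker_synthesis_iff hw hf).1 hd,
    indicatorConstLp_coeFn (p := 2) (hs := hA) (hμs := measure_ne_top ν A) (c := (1 : ℂ))]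
    with x hx h1
  rw [h1]
  by_cases hxA : x ∈ A
  · rw [hx (hAw x hxA), inner_zero_left, Pi.zero_apply]
  · rw [Set.indicator_of_notMem hxA, inner_zero_right, Pi.zero_apply]

/-- Testing the frame inequalities on indicators of sets where the weight does not vanish bounds
the weight itself. -/
theorem HasWeight.bounds_of_isFrameSequence [IsFiniteMeasure ν] (h : HasWeight f b w)
    (hw : Measurable w) (hfr : IsFrameSequence f C D) :
    ∀ᵐ x ∂ν, w x ≠ 0 → ENNReal.ofReal C ≤ w x ∧ w x ≤ ENNReal.ofReal D := by
  obtain ⟨hC, hCD, hf, hbound⟩ := hfr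
  have hN : MeasurableSet {x | w x ≠ 0} := (hw (measurableSet_singleton 0)).compl
  have key : ∀ A : Set α, MeasurableSet A → A ⊆ {x | w x ≠ 0} →
      ENNReal.ofReal C * ν A ≤ ∫⁻ x in A, w x ∂ν ∧
        ∫⁻ x in A, w x ∂ν ≤ ENNReal.ofReal D * ν A := by
    intro A hA hAw
    set m : Lp ℂ 2 ν := indicatorConstLp 2 hA (measure_ne_top ν A) (1 : ℂ) with hm
    have hae : m =ᵐ[ν] A.indicator fun _ => (1 : ℂ) := indicatorConstLp_coeFn
    have h1 : ‖b.repr m‖ₑ ^ 2 = ν A := by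
      rw [← enorm_repr_symm b, LinearIsometryEquiv.symm_apply_apply,
        enorm_sq_eq_lintegral_enorm_sq, ← lintegral_indicator_one hA]
      refine lintegral_congr_ae ?_
      filter_upwards [hae] with x hx
      rw [hx]
      by_cases hxA : x ∈ A <;> simp [hxA]
    have h2 : ‖synthesis f hf (b.repr m)‖ₑ ^ 2 = ∫⁻ x in A, w x ∂ν := by
      rw [h.enorm_synthesis_sq, LinearIsometryEquiv.symm_apply_apply, ← lintegral_indicator hA]
      refine lintegral_congr_ae ?_
      filter_upwards [hae] with x hx
      rw [hx]
      by_cases hxA : x ∈ A <;> simp [hxA]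
    have h3 := hbound _ (h.repr_indicator_mem_orthogonal hw hf hA hAw)
    rw [← hm] at h3
    rw [← h1, ← h2]
    constructor
    · simpa using (ofReal_mul_enorm_sq_le_iff hC.le zero_le_one (b.repr m)
        (synthesis f hf (b.repr m))).2 (by simpa using h3.1)
    · simpa using (ofReal_mul_enorm_sq_le_iff zero_le_one (hC.le.trans hCD)
        (synthesis f hf (b.repr m)) (b.repr m)).2 (by simpa using h3.2)
  have hlow : (fun _ => ENNReal.ofReal C) ≤ᵐ[ν.restrict {x | w x ≠ 0}] w := by
    refine ae_le_of_forall_setLIntegral_le_of_sigmaFinite measurable_const fun s hs _ => ?_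
    rw [Measure.restrict_restrict hs, setLIntegral_const]
    exact (key _ (hs.inter hN) Set.inter_subset_right).1
  have hup : w ≤ᵐ[ν.restrict {x | w x ≠ 0}] fun _ => ENNReal.ofReal D := by
    refine ae_le_of_forall_setLIntegral_le_of_sigmaFinite hw fun s hs _ => ?_
    rw [Measure.restrict_restrict hs, setLIntegral_const]
    exact (key _ (hs.inter hN) Set.inter_subset_right).2
  filter_upwards [(ae_restrict_iff' hN).1 hlow, (ae_restrict_iff' hN).1 hup] with x h1 h2 hx
  exact ⟨h1 hx, h2 hx⟩

theorem HasWeight.norm_sq_le (h : HasWeight f b w) (hD : 0 ≤ D)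
    (hwD : ∀ᵐ x ∂ν, w x ≤ ENNReal.ofReal D) {c : lp (fun _ : ι => ℂ) 2} {v : E}
    (hv : HasSum (fun j => c j • f j) v) : ‖v‖ ^ 2 ≤ D * ‖c‖ ^ 2 := by
  have h1 : ‖v‖ₑ ^ 2 ≤ ENNReal.ofReal D * ‖c‖ₑ ^ 2 := by
    rw [h c v hv, ← enorm_repr_symm b, enorm_sq_eq_lintegral_enorm_sq, mul_comm,
      ← lintegral_mul_const' _ _ ENNReal.ofReal_ne_top]
    refine lintegral_mono_ae ?_
    filter_upwards [hwD] with x hx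
    gcongr
  simpa using (ofReal_mul_enorm_sq_le_iff zero_le_one hD v c).1 (by simpa using h1)

theorem HasWeight.synthesisWellDefined [CompleteSpace E] (h : HasWeight f b w) (hD : 0 ≤ D)
    (hwD : ∀ᵐ x ∂ν, w x ≤ ENNReal.ofReal D) : SynthesisWellDefined f := by
  classical
  intro c
  have hc : Summable fun j => D * ‖c j‖ ^ 2 := by
    have := (lp.memℓp c).summable (by norm_num)
    simpa using this.mul_left D
  rw [summable_iff_vanishing_norm]
  intro ε hε
  obtain ⟨s, hs⟩ := summable_iff_vanishing_norm.1 hc (ε ^ 2) (by positivity)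
  refine ⟨s, fun t ht => ?_⟩
  set d : lp (fun _ : ι => ℂ) 2 := ∑ j ∈ t, lp.single 2 j (c j) with hd
  have hdj : ∀ j, d j = if j ∈ t then c j else 0 := by
    intro j
    rw [hd, lp.coeFn_sum, Finset.sum_apply]
    simp [lp.single_apply, Pi.single_apply]
  have h1 : HasSum (fun j => d j • f j) (∑ j ∈ t, c j • f j) := by
    rw [Finset.sum_congr rfl fun j hj => by rw [← if_pos hj (t := c j) (e := 0), ← hdj]]
    exact hasSum_sum_of_ne_finset_zero fun j hj => by rw [hdj, if_neg hj, zero_smul]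
  have h2 := h.norm_sq_le hD hwD h1
  have h3 : ‖d‖ ^ 2 = ∑ j ∈ t, ‖c j‖ ^ 2 := by
    have := lp.norm_sum_single (p := 2) (by norm_num) (fun j => c j) t
    simpa using this
  rw [h3, Finset.mul_sum] at h2
  have h4 := hs t ht
  rw [Real.norm_eq_abs] at h4
  exact lt_of_pow_lt_pow_left₀ 2 hε.le (h2.trans_lt ((le_abs_self _).trans_lt h4))

/-- The symbol of a sequence orthogonal to the kernel vanishes where the weight does. -/
theorem HasWeight.repr_symm_eq_zero_of_mem_orthogonal (h : HasWeight f b w) (hw : Measurable w)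
    (hf : SynthesisWellDefined f) {c : lp (fun _ : ι => ℂ) 2}
    (hc : c ∈ (LinearMap.ker (synthesis f hf))ᗮ) :
    ∀ᵐ x ∂ν, w x = 0 → b.repr.symm c x = 0 := by
  have hZ : MeasurableSet {x | w x = 0} := hw (measurableSet_singleton 0)
  have hm : MemLp ({x | w x = 0}.indicator (b.repr.symm c)) 2 ν := (Lp.memLp _).indicator hZ
  set m : Lp ℂ 2 ν := hm.toLp _ with hm_def
  have hae : m =ᵐ[ν] {x | w x = 0}.indicator (b.repr.symm c) := hm.coeFn_toLp
  have hker : b.repr m ∈ LinearMap.ker (synthesis f hf) := by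
    rw [h.mem_ker_synthesis_iff hw, LinearIsometryEquiv.symm_apply_apply]
    filter_upwards [hae] with x hx hwx
    rw [hx, Set.indicator_of_notMem (show x ∉ {x | w x = 0} from hwx)]
  have h0 : (inner ℂ m (b.repr.symm c) : ℂ) = 0 := by
    rw [← LinearIsometryEquiv.inner_map_map b.repr, LinearIsometryEquiv.apply_symm_apply]
    exact (Submodule.mem_orthogonal _ _).1 hc _ hker
  have h1 : (inner ℂ m m : ℂ) = inner ℂ m (b.repr.symm c) := by
    rw [L2.inner_def, L2.inner_def]
    refine integral_congr_ae ?_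
    filter_upwards [hae] with x hx
    rw [hx]
    by_cases hxZ : x ∈ {x | w x = 0}
    · rw [Set.indicator_of_mem hxZ]
    · rw [Set.indicator_of_notMem hxZ, inner_zero_left, inner_zero_left]
  have h2 : m = 0 := inner_self_eq_zero.1 (h1.trans h0)
  rw [h2] at hae
  filter_upwards [hae, Lp.coeFn_zero ℂ 2 ν] with x hx hx0 hwx
  rw [hx0, Set.indicator_of_mem (show x ∈ {x | w x = 0} from hwx)] at hx
  exact hx.symm

theorem HasWeight.isFrameSequence_of_bounds [CompleteSpace E] (h : HasWeight f b w)
    (hw : Measurable w) (hC : 0 < C) (hCD : C ≤ D)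
    (hbd : ∀ᵐ x ∂ν, w x ≠ 0 → ENNReal.ofReal C ≤ w x ∧ w x ≤ ENNReal.ofReal D) :
    IsFrameSequence f C D := by
  have hD : 0 ≤ D := hC.le.trans hCD
  have hwD : ∀ᵐ x ∂ν, w x ≤ ENNReal.ofReal D := by
    filter_upwards [hbd] with x hx
    by_cases h0 : w x = 0
    · simp [h0]
    · exact (hx h0).2
  refine ⟨hC, hCD, h.synthesisWellDefined hD hwD, fun c hc =>
    ⟨?_, h.norm_sq_le hD hwD (h.synthesisWellDefined hD hwD c).hasSum⟩⟩
  have h1 : ENNReal.ofReal C * ‖c‖ₑ ^ 2 ≤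
      ‖synthesis f (h.synthesisWellDefined hD hwD) c‖ₑ ^ 2 := by
    rw [h.enorm_synthesis_sq, ← enorm_repr_symm b, enorm_sq_eq_lintegral_enorm_sq, mul_comm,
      ← lintegral_mul_const' _ _ ENNReal.ofReal_ne_top]
    refine lintegral_mono_ae ?_
    filter_upwards [hbd, h.repr_symm_eq_zero_of_mem_orthogonal hw _ hc] with x hx hx0
    by_cases h0 : w x = 0
    · simp [hx0 h0]
    · gcongr
      exact (hx h0).1
  simpa using (ofReal_mul_enorm_sq_le_iff hC.le zero_le_one c
    (synthesis f (h.synthesisWellDefined hD hwD) c)).1 (by simpa using h1)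

end WeightedFrame

namespace Vilenkin

/-! ### Synthesis of translates and periodization -/

section Periodization

variable {p : ℕ} [NeZero p]

/-- The periodization `u ↦ ∑_{h ∈ H} |f(h + u)|²` on `U`, with values in `[0, ∞]`. -/
noncomputable def periodization (f : VilenkinGroup p → ℂ) (u : U p 0) : ℝ≥0∞ :=
  ∑' h : H p, ‖f (h + u)‖ₑ ^ 2

theorem aemeasurable_enorm_sq_coset (f : L2 p) (h : H p) :
    AEMeasurable (fun u : U p 0 => ‖f (h + u)‖ₑ ^ 2) (haarU p) :=
  ((Lp.aestronglyMeasurable f).comp_quasiMeasurePreserving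
    (quasiMeasurePreserving_add_val (h : VilenkinGroup p))).enorm.pow_const 2

theorem aemeasurable_periodization (f : L2 p) : AEMeasurable (periodization f) (haarU p) :=
  AEMeasurable.tsum (aemeasurable_enorm_sq_coset f)

theorem periodization_ne_top (f : L2 p) : ∀ᵐ u ∂(haarU p), periodization f u ≠ ∞ := by
  refine (ae_lt_top' (aemeasurable_periodization f) ?_).mono fun u hu => hu.ne
  have : ∫⁻ u, periodization f u ∂(haarU p) = ‖f‖ₑ ^ 2 := by
    rw [enorm_sq_eq_tsum, ← lintegral_tsum (aemeasurable_enorm_sq_coset f)]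
    rfl
  rw [this]
  exact ENNReal.pow_ne_top enorm_ne_top

/-- On each coset of `U*`, the Fourier transform of `∑ c_h T_h φ` is that of `φ` times the Fourier
series with coefficients `c`. -/
theorem cosetRestrict_fourier_of_hasSum (φ : L2 p) {c : lp (fun _ : H p => ℂ) 2} {v : L2 p}
    (hv : HasSum (fun h : H p => c h • translate (h : VilenkinGroup p) φ) v) (k : H p) :
    cosetRestrict k (fourier p v) =ᵐ[haarU p]
      fun u => (basisU p).repr.symm c u * cosetRestrict k (fourier p φ) u := by
  set ψ := cosetRestrict k (fourier p φ) with hψ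
  -- The products of the two convergent series in `L²(U)` with `ψ` and with `1` converge in `L¹(U)`.
  set B := (ContinuousLinearMap.mul ℂ ℂ).holderL (haarU p) 2 2 1 with hB
  have hBcoe : ∀ f g : Lp ℂ 2 (haarU p), B f g =ᵐ[haarU p] fun u => f u * g u := fun f g =>
    (ContinuousLinearMap.mul ℂ ℂ).coeFn_holder (r := 1) f g
  have hone : basisU p 0 =ᵐ[haarU p] fun _ => (1 : ℂ) := by
    filter_upwards [coeFn_basisU (0 : H p)] with u hu
    rw [hu, show ((0 : H p) : VilenkinGroup p) = 0 from rfl, charU_zero, ContinuousMap.one_apply]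
  have h1 : HasSum (fun h : H p => c h • B (basisU p h) ψ) (B ((basisU p).repr.symm c) ψ) := by
    simpa using ((basisU p).hasSum_repr_symm c).mapL (B.flip ψ)
  have h2 : HasSum (fun h : H p => c h • B (basisU p 0)
      (cosetRestrict k (fourier p (translate (h : VilenkinGroup p) φ))))
      (B (basisU p 0) (cosetRestrict k (fourier p v))) := by
    simpa using hv.mapL (B (basisU p 0) ∘L cosetRestrict (k : VilenkinGroup p) ∘L fourier p)
  have h3 : ∀ h : H p, B (basisU p h) ψ = B (basisU p 0)
      (cosetRestrict k (fourier p (translate (h : VilenkinGroup p) φ))) := by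
    intro h
    refine Lp.ext ?_
    filter_upwards [hBcoe (basisU p h) ψ, hBcoe (basisU p 0)
      (cosetRestrict k (fourier p (translate (h : VilenkinGroup p) φ))), hone, coeFn_basisU h,
      cosetRestrict_fourier_translate k h φ] with u e1 e2 e3 e4 e5
    rw [e1, e2, e3, e4, e5, one_mul]
  simp only [h3] at h1
  have h4 := h2.unique h1
  filter_upwards [hBcoe (basisU p 0) (cosetRestrict k (fourier p v)),
    hBcoe ((basisU p).repr.symm c) ψ, hone] with u e1 e2 e3
  rw [← e2, ← h4, e1, e3, one_mul]

theorem hasWeight_translate (φ : L2 p) {w : U p 0 → ℝ≥0∞}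
    (hw : periodization (fourier p φ) =ᵐ[haarU p] w) :
    HasWeight (fun h : H p => translate (h : VilenkinGroup p) φ) (basisU p) w := by
  intro c v hv
  rw [← enorm_fourier, enorm_sq_eq_tsum,
    ← lintegral_tsum (aemeasurable_enorm_sq_coset (fourier p v))]
  have h1 : ∀ᵐ u : U p 0 ∂(haarU p), ∀ k : H p, fourier p v (k + u) =
      (basisU p).repr.symm c u * fourier p φ (k + u) := by
    refine ae_all_iff.2 fun k => ?_
    filter_upwards [cosetRestrict_fourier_of_hasSum φ hv k,
      coeFn_cosetRestrict (k : VilenkinGroup p) (fourier p v),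
      coeFn_cosetRestrict (k : VilenkinGroup p) (fourier p φ)] with u e1 e2 e3
    rw [← e2, e1, e3]
  refine lintegral_congr_ae ?_
  filter_upwards [h1, hw] with u h1 hw
  simp only [h1, enorm_mul, mul_pow, ENNReal.tsum_mul_left]
  rw [← hw, periodization]

variable (p) in
/-- `H^⊥` consists of the same sequences as `H`. -/
def equivHperp : H p ≃ Hperp p :=
  Equiv.subtypeEquivRight fun _ => mem_Hperp_iff.symm

theorem periodization_eq_ofReal_bracket {f : VilenkinGroup p → ℂ} {u : U p 0}
    (hu : periodization f u ≠ ∞) :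
    periodization f u = ENNReal.ofReal (bracket f f u).re := by
  have h1 : (bracket f f u).re = ∑' h : H p, ‖f (h + u)‖ ^ 2 := by
    rw [bracket_self, Complex.ofReal_re, ← (equivHperp p).tsum_eq]
    refine tsum_congr fun h => ?_
    rw [add_comm]
    rfl
  have h2 : ∀ h : H p, ‖f (h + u)‖ₑ ^ 2 = ENNReal.ofReal (‖f (h + u)‖ ^ 2) := fun h => by
    rw [ENNReal.ofReal_pow (norm_nonneg _), ofReal_norm]
  have h3 : Summable fun h : H p => ‖f (h + u)‖ ^ 2 := by
    simpa using ENNReal.summable_toReal hu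
  rw [h1, ENNReal.ofReal_tsum_of_nonneg (fun h => by positivity) h3, periodization]
  simp only [h2]

theorem bracket_self_re_nonneg (f : VilenkinGroup p → ℂ) (ω : VilenkinGroup p) :
    0 ≤ (bracket f f ω).re := by
  rw [bracket_self, Complex.ofReal_re]
  exact tsum_nonneg fun h => by positivity

theorem bracket_self_eq_zero_iff (f : VilenkinGroup p → ℂ) (ω : VilenkinGroup p) :
    bracket f f ω = 0 ↔ (bracket f f ω).re = 0 := by
  rw [bracket_self, Complex.ofReal_re, Complex.ofReal_eq_zero]

end Periodization

end Vilenkin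

theorem mainTheorem1 (p : ℕ) [NeZero p] (φ : Vilenkin.L2 p) (C D : ℝ) (hC : 0 < C) (hCD : C ≤ D) :
    IsFrameSequence (fun h : Vilenkin.H p => Vilenkin.translate (h : VilenkinGroup p) φ) C D ↔
      ∀ᵐ ω ∂(Vilenkin.haar p), ω ∈ (Vilenkin.U p 0 : Set (VilenkinGroup p)) \ Vilenkin.zeroSet φ →
        C ≤ (Vilenkin.bracket (Vilenkin.fourier p φ) (Vilenkin.fourier p φ) ω).re ∧
        (Vilenkin.bracket (Vilenkin.fourier p φ) (Vilenkin.fourier p φ) ω).re ≤ D := by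
  have hm := Vilenkin.aemeasurable_periodization (Vilenkin.fourier p φ)
  have hwt := Vilenkin.hasWeight_translate φ hm.ae_eq_mk
  have h1 : IsFrameSequence (fun h : Vilenkin.H p => Vilenkin.translate (h : VilenkinGroup p) φ)
      C D ↔ ∀ᵐ u ∂(Vilenkin.haarU p), hm.mk _ u ≠ 0 →
        ENNReal.ofReal C ≤ hm.mk _ u ∧ hm.mk _ u ≤ ENNReal.ofReal D :=
    ⟨hwt.bounds_of_isFrameSequence hm.measurable_mk,
      hwt.isFrameSequence_of_bounds hm.measurable_mk hC hCD⟩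
  have h2 : ∀ P : VilenkinGroup p → Prop,
      (∀ᵐ ω ∂(Vilenkin.haar p), ω ∈ (Vilenkin.U p 0 : Set (VilenkinGroup p)) → P ω) ↔
        ∀ᵐ u : Vilenkin.U p 0 ∂(Vilenkin.haarU p), P u := fun P => by
    rw [← ae_restrict_iff' (Vilenkin.measurableSet_U p),
      ae_restrict_iff_subtype (Vilenkin.measurableSet_U p)]
    rfl
  have h3 : ∀ ω, (ω ∈ (Vilenkin.U p 0 : Set (VilenkinGroup p)) \ Vilenkin.zeroSet φ →
        C ≤ (Vilenkin.bracket (Vilenkin.fourier p φ) (Vilenkin.fourier p φ) ω).re ∧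
        (Vilenkin.bracket (Vilenkin.fourier p φ) (Vilenkin.fourier p φ) ω).re ≤ D) ↔
      (ω ∈ (Vilenkin.U p 0 : Set (VilenkinGroup p)) →
        (Vilenkin.bracket (Vilenkin.fourier p φ) (Vilenkin.fourier p φ) ω).re ≠ 0 →
        C ≤ (Vilenkin.bracket (Vilenkin.fourier p φ) (Vilenkin.fourier p φ) ω).re ∧
        (Vilenkin.bracket (Vilenkin.fourier p φ) (Vilenkin.fourier p φ) ω).re ≤ D) := by
    intro ω
    rw [Set.mem_sdiff, Vilenkin.zeroSet, Set.mem_ofPred_eq, Vilenkin.bracket_self_eq_zero_iff,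
      SetLike.mem_coe]
    tauto
  simp only [h3]
  rw [h1, h2]
  -- Where the periodization is infinite, the real bracket has a junk value; this set is null.
  refine eventually_congr ?_
  filter_upwards [hm.ae_eq_mk, Vilenkin.periodization_ne_top (Vilenkin.fourier p φ)] with u hu htop
  have hnn := Vilenkin.bracket_self_re_nonneg (Vilenkin.fourier p φ) (u : VilenkinGroup p)
  rw [← hu, Vilenkin.periodization_eq_ofReal_bracket htop, ENNReal.ofReal_le_ofReal_iff hnn,
    ENNReal.ofReal_le_ofReal_iff (hC.le.trans hCD), Ne, ENNReal.ofReal_eq_zero, hnn.ge_iff_eq',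
    ← ne_eq, ne_comm]
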